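/- Setting. Let $T>0$, $s\ge 0$, and let $q\in L^\infty(0,1)$ be real-valued. Let $\mathcal L=-\frac{d^2}{dx^2}+q$ be the Sturm–Liouville operator in the complex space $L^2(0,1)$ with Dirichlet boundary conditions $y(0)=y(1)=0$, and let $\lambda_n$, $\phi_n$ ($n\ge 1$) be its eigenvalues and $L^2$-normalised eigenfunctions. Assume that all eigenvalues of $\mathcal L$ are positive. For $r\ge 0$ put $\mathcal L^{r}f=\sum_n\lambda_n^{r}\langle f,\phi_n\rangle\phi_n$ whenever the series converges in $L^2(0,1)$, let $W^s_{\mathcal L}(0,1)=\{f\in L^2(0,1):\mathcal L^{s/2}f\in L^2(0,1)\}$, and let $\|f\|_{W^s_{\mathcal L}}=\|\mathcal L^{s/2}f\|_{L^2}$. For non-negative $a,b\in L^\infty(0,1)$, $u_0\in W^s_{\mathcal L}(0,1)$ and $u_1\in L^2(0,1)$ consider the problem $$\partial_t^2u+\mathcal L^su+a(x)u+b(x)\partial_tu=0\ \text{ on }[0,T]\times(0,1),\qquad u(0,\cdot)=u_0,\quad \partial_tu(0,\cdot)=u_1,\qquad u(t,0)=u(t,1)=0. \tag{P}$$ A solution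 of (P) is a function $u\in C([0,T];W^s_{\mathcal L}(0,1))\cap C^1([0,T];L^2(0,1))$ with these initial values such that for every $w\in W^s_{\mathcal L}(0,1)$ and every $t\in[0,T]$ $$\frac{d}{dt}\langle \partial_tu(t),w\rangle+\langle\mathcal L^{s/2}u(t),\mathcal L^{s/2}w\rangle+\langle a\,u(t),w\rangle+\langle b\,\partial_tu(t),w\rangle=0,$$ where $\langle\cdot,\cdot\rangle$ is the inner product of $L^2(0,1)$; the boundary conditions are the Dirichlet conditions built into $\mathcal L$ and $W^s_{\mathcal L}$. A net $(f_\varepsilon)_{\varepsilon\in(0,1]}$ in a normed space $X$ is $X$-moderate if there are $N\in\mathbb N_0$ and $C>0$ with $\|f_\varepsilon\|_X\le C\varepsilon^{-N}$ for all $\varepsilon\in(0,1]$. Let $(a_\varepsilon)$, $(b_\varepsilon)$ be $L^\infty$-moderate nets of non-negative functions, $(u_{0,\varepsilon})$ a $W^s_{\mathcal L}$-moderate net and $(u_{1,\varepsilon})$ an $L^2$-moderate net. A net $(u_\varepsilon)_{\varepsilon\in(0,1]}$ is a very weak solution belonging to these regularising nets if, for every $\varepsilon\in(0,1]$, $u_\varepsilon$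 is a solution of (P) with $a_\varepsilon,b_\varepsilon,u_{0,\varepsilon},u_{1,\varepsilon}$ in place of $a,b,u_0,u_1$, and there are $N\in\mathbb N_0$ and $C>0$ with $$\sup_{t\in[0,T]}\big(\|u_\varepsilon(t)\|_{L^2}+\|\mathcal L^{s/2}u_\varepsilon(t)\|_{L^2}+\|\partial_tu_\varepsilon(t)\|_{L^2}\big)\le C\varepsilon^{-N}\quad\text{for all }\varepsilon\in(0,1].$$ Theorem (Consistency, case $s\ge 0$). Let $a,b\in L^\infty(0,1)$ be non-negative, $u_0\in W^s_{\mathcal L}(0,1)$, $u_1\in L^2(0,1)$, and let $u$ be a (classical) solution of (P). Then for any regularising nets as above with $$\|a_\varepsilon-a\|_{L^\infty}\to0,\quad \|b_\varepsilon-b\|_{L^\infty}\to0,\quad \|u_{0,\varepsilon}-u_0\|_{W^s_{\mathcal L}}\to0,\quad \|u_{1,\varepsilon}-u_1\|_{L^2}\to0\qquad(\varepsilon\to0),$$ and any very weak solution $(u_\varepsilon)_\varepsilon$ belonging to them, $$\sup_{t\in[0,T]}\|u_\varepsilon(t,\cdot)-u(t,\cdot)\|_{L^2(0,1)}\to0\qquad(\varepsilon\to0).$$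 -/

import Mathlib

open Set Filter Topology MeasureTheory
open scoped ENNReal

noncomputable section

namespace SturmLiouville

/-- Lebesgue measure on the interval `(0,1)`. -/
abbrev unitMeasure : Measure ℝ := volume.restrict (Ioo (0 : ℝ) 1)

/-- The complex Hilbert space `L²(0,1)`. -/
abbrev L2 : Type := Lp ℂ 2 unitMeasure

/-- The space `L^∞(0,1)` of real-valued functions. It acts on `L²(0,1)` by pointwise
multiplication, written `a • f`. -/
abbrev LInf : Type := Lp ℝ ∞ unitMeasure

/-- `-y'' + q y = g` on `(0,1)` with `y(0) = y(1) = 0`, where `f` is the class of `y` in `L²(0,1)`: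
`y` is differentiable on `[0,1]` and its derivative `v` is absolutely continuous, with
`v' = q f - g` almost everywhere. -/
def IsDirichletPair (q : LInf) (f g : L2) : Prop :=
  ∃ y v : ℝ → ℂ, f =ᵐ[unitMeasure] y ∧ y 0 = 0 ∧ y 1 = 0 ∧
    (∀ x ∈ Icc (0 : ℝ) 1, HasDerivWithinAt y (v x) (Icc 0 1) x) ∧
    ∀ x ∈ Icc (0 : ℝ) 1, v x = v 0 + ∫ t in Ioo 0 x, (q • f - g : L2) t

theorem integrableOn_L2 (h : L2) {x : ℝ} (hx : x ≤ 1) :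
    IntegrableOn (fun t => h t) (Ioo 0 x) := by
  have h1 : Integrable (fun t => h t) unitMeasure :=
    (Lp.memLp h).integrable (by norm_num)
  exact IntegrableOn.mono_set (t := Ioo (0 : ℝ) 1) h1 (Ioo_subset_Ioo_right hx)

theorem ae_Ioo {p : ℝ → Prop} (h : ∀ᵐ t ∂unitMeasure, p t) {x : ℝ} (hx : x ≤ 1) :
    ∀ᵐ t ∂(volume.restrict (Ioo (0 : ℝ) x)), p t :=
  ae_restrict_of_ae_restrict_of_subset (Ioo_subset_Ioo_right hx) h

theorem smul_mul_L2 (q : LInf) (c : ℂ) (f : L2) :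
    (q • (c • f : L2) : L2) = c • (q • f : L2) := by
  apply Lp.ext
  filter_upwards [Lp.coeFn_lpSMul (r := 2) q (c • f), Lp.coeFn_lpSMul (r := 2) q f,
    Lp.coeFn_smul c f, Lp.coeFn_smul c (q • f : L2)] with x h1 h2 h3 h4
  simp only [h1, h2, h3, h4, Pi.smul_apply, Pi.smul_apply']
  exact smul_comm _ _ _

/-- The graph of the Sturm-Liouville operator `L = -d²/dx² + q` in `L²(0,1)` with Dirichlet
boundary conditions: the pairs `(f, L f)` with `f` in the domain of `L`. -/
def graph (q : LInf) : Submodule ℂ (L2 × L2) where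
  carrier := {p | IsDirichletPair q p.1 p.2}
  zero_mem' := by
    refine ⟨0, 0, Lp.coeFn_zero _ _ _, rfl, rfl, fun x _ => hasDerivWithinAt_const x _ 0, ?_⟩
    intro x hx
    have h0 : (q • (0 : L2 × L2).1 - (0 : L2 × L2).2 : L2) = 0 := by simp
    rw [h0, integral_congr_ae (ae_Ioo (Lp.coeFn_zero ℂ 2 unitMeasure) hx.2)]
    simp
  add_mem' := by
    rintro ⟨f₁, g₁⟩ ⟨f₂, g₂⟩ ⟨y₁, v₁, hy₁, h₁0, h₁1, hd₁, hv₁⟩ ⟨y₂, v₂, hy₂, h₂0, h₂1, hd₂, hv₂⟩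
    refine ⟨y₁ + y₂, v₁ + v₂, (Lp.coeFn_add f₁ f₂).trans (hy₁.add hy₂), by simp [h₁0, h₂0],
      by simp [h₁1, h₂1], fun x hx => (hd₁ x hx).add (hd₂ x hx), ?_⟩
    intro x hx
    have h0 : (q • ((f₁, g₁) + (f₂, g₂) : L2 × L2).1 - ((f₁, g₁) + (f₂, g₂) : L2 × L2).2 : L2)
        = (q • f₁ - g₁ : L2) + (q • f₂ - g₂ : L2) := by
      simp only [Prod.mk_add_mk]
      rw [Lp.add_smul q f₁ f₂]
      abel
    rw [h0, integral_congr_ae (ae_Ioo (Lp.coeFn_add _ _) hx.2)]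
    simp only [Pi.add_apply]
    rw [integral_add (integrableOn_L2 _ hx.2) (integrableOn_L2 _ hx.2)]
    have e1 := hv₁ x hx
    have e2 := hv₂ x hx
    dsimp only at e1 e2
    rw [e1, e2]
    ring
  smul_mem' := by
    rintro c ⟨f, g⟩ ⟨y, v, hy, h0, h1, hd, hv⟩
    refine ⟨c • y, c • v, (Lp.coeFn_smul c f).trans (hy.const_smul c), by simp [h0],
      by simp [h1], fun x hx => (hd x hx).const_smul c, ?_⟩
    intro x hx
    have e0 : (q • (c • (f, g) : L2 × L2).1 - (c • (f, g) : L2 × L2).2 : L2)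
        = c • (q • f - g : L2) := by
      simp only [Prod.smul_mk, smul_sub]
      rw [smul_mul_L2]
    rw [e0, integral_congr_ae (ae_Ioo (Lp.coeFn_smul c _) hx.2)]
    simp only [Pi.smul_apply]
    rw [integral_smul, hv x hx, smul_add]

/-- The eigenspace `{f ∈ Dom L : L f = lam f}`. -/
def eigenspace (q : LInf) (lam : ℝ) : Submodule ℂ L2 :=
  (graph q).comap (LinearMap.prod LinearMap.id ((lam : ℂ) • LinearMap.id))

/-- `lam` is an eigenvalue of `L`. -/
def IsEigenvalue (q : LInf) (lam : ℝ) : Prop := eigenspace q lam ≠ ⊥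

/-- Orthogonal projection of `L²(0,1)` onto the eigenspace of `lam`, i.e. `f ↦ ⟨f, φ⟩ φ` if `lam` is
an eigenvalue with normalised eigenfunction `φ`, and `0` if `lam` is not an eigenvalue. (Eigenspaces
are finite dimensional, so taking the closure changes nothing.) -/
def spectralProj (q : LInf) (lam : ℝ) : L2 →L[ℂ] L2 :=
  (eigenspace q lam).topologicalClosure.starProjection

/-- `f` belongs to the domain of `L^r`: the eigenfunction expansion `∑ λₙ^r fₙ φₙ` converges in
`L²(0,1)`. The sum over all real `lam` has nonzero terms only at the eigenvalues. -/
def MemDomPow (q : LInf) (r : ℝ) (f : L2) : Prop :=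
  Summable fun lam : ℝ => (lam ^ r) • spectralProj q lam f

/-- The fractional power `L^r f = ∑ λₙ^r fₙ φₙ`. -/
def fracPow (q : LInf) (r : ℝ) (f : L2) : L2 :=
  ∑' lam : ℝ, (lam ^ r) • spectralProj q lam f

/-- `f ∈ W^s_L(0,1)`, for `s ≥ 0`: `f` is in `L²(0,1)`, with `L^{s/2} f ∈ L²(0,1)`. -/
def MemW (q : LInf) (s : ℝ) (f : L2) : Prop := MemDomPow q (s / 2) f

/-- The norm `‖f‖_{W^s_L} = ‖L^{s/2} f‖_{L²}`. -/
def normW (q : LInf) (s : ℝ) (f : L2) : ℝ := ‖fracPow q (s / 2) f‖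

/-- The time derivative `∂ₜ u` on `[0,T]` (one-sided at the end points) of an `L²`-valued
function. -/
def dt (T : ℝ) (u : ℝ → L2) : ℝ → L2 := derivWithin u (Icc 0 T)

/-- `u ∈ C([0,T]; W^s_L(0,1)) ∩ C¹([0,T]; L²(0,1))` solves
`∂ₜ²u + L^s u + a u + b ∂ₜu = 0` on `[0,T] × (0,1)`, `u(0) = u₀`, `∂ₜu(0) = u₁`, with
Dirichlet boundary conditions. The equation holds in the dual of `W^s_L(0,1)`, at every time; the
boundary conditions are those of the eigenfunctions that generate `W^s_L(0,1)`. -/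
structure IsSolution (q : LInf) (s T : ℝ) (a b : LInf) (u₀ u₁ : L2) (u : ℝ → L2) : Prop where
  memW : ∀ t ∈ Icc 0 T, MemW q s (u t)
  continuousOn_W : ∀ t ∈ Icc 0 T,
    Tendsto (fun τ => normW q s (u τ - u t)) (𝓝[Icc 0 T] t) (𝓝 0)
  contDiffOn : ContDiffOn ℝ 1 u (Icc 0 T)
  equation : ∀ w : L2, MemW q s w → ∀ t ∈ Icc 0 T,
    HasDerivWithinAt (fun τ => inner ℂ w (dt T u τ))
      (-(inner ℂ (fracPow q (s / 2) w) (fracPow q (s / 2) (u t))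
        + inner ℂ w (a • u t : L2) + inner ℂ w (b • dt T u t : L2)))
      (Icc 0 T) t
  initial : u 0 = u₀
  initial_dt : dt T u 0 = u₁

/-- A net of non-negative numbers (the norms of a net indexed by `ε ∈ (0,1]`) is moderate if it is
`O(ε^{-N})` on `(0,1]` for some `N`. -/
def IsModerate (n : ℝ → ℝ) : Prop :=
  ∃ N : ℕ, ∃ C : ℝ, ∀ ε ∈ Ioc (0 : ℝ) 1, n ε ≤ C * (ε⁻¹) ^ N

/-- `sup_{t ∈ [0,T]} (‖u_ε(t)‖_{L²} + ‖L^{s/2} u_ε(t)‖_{L²} + ‖∂ₜu_ε(t)‖_{L²}) = O(ε^{-N})` on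
`(0,1]` for some `N`. -/
def IsUniformlyModerate (q : LInf) (s T : ℝ) (u : ℝ → ℝ → L2) : Prop :=
  ∃ N : ℕ, ∃ C : ℝ, ∀ ε ∈ Ioc (0 : ℝ) 1, ∀ t ∈ Icc 0 T,
    ‖u ε t‖ + ‖fracPow q (s / 2) (u ε t)‖ + ‖dt T (u ε) t‖ ≤ C * (ε⁻¹) ^ N

/-- The net `(u_ε)`, `ε ∈ (0,1]`, is the very weak solution belonging to the regularising nets
`(a_ε)`, `(b_ε)` of the coefficients and `(u_{0,ε})`, `(u_{1,ε})` of the initial data: these nets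
are moderate, the coefficients are non-negative, `u_ε` solves the problem with coefficients
`a_ε, b_ε` and data `u_{0,ε}, u_{1,ε}`, and `(u_ε)` is uniformly `s`-moderate. -/
structure IsVeryWeakSolution (q : LInf) (s T : ℝ) (a b : ℝ → LInf) (u₀ u₁ : ℝ → L2)
    (u : ℝ → ℝ → L2) : Prop where
  nonneg_a : ∀ ε ∈ Ioc (0 : ℝ) 1, 0 ≤ a ε
  nonneg_b : ∀ ε ∈ Ioc (0 : ℝ) 1, 0 ≤ b ε
  memW : ∀ ε ∈ Ioc (0 : ℝ) 1, MemW q s (u₀ ε)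
  moderate_a : IsModerate fun ε => ‖a ε‖
  moderate_b : IsModerate fun ε => ‖b ε‖
  moderate_u₀ : IsModerate fun ε => normW q s (u₀ ε)
  moderate_u₁ : IsModerate fun ε => ‖u₁ ε‖
  isSolution : ∀ ε ∈ Ioc (0 : ℝ) 1, IsSolution q s T (a ε) (b ε) (u₀ ε) (u₁ ε) (u ε)
  moderate : IsUniformlyModerate q s T u

end SturmLiouville

end

noncomputable section

namespace SturmLiouville

/-! ### Hilbert-Schmidt operators are compact -/

/-! The difference `w` of a perturbed and the classical solution satisfies `w'' + L^s w = g`, where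
`g` collects the terms of order zero and one in time. Splitting `a' u' - a u = a' (u' - u) + (a' -
a) u`, and likewise for the damping, gives `‖g‖ ≤ δ + K (‖w‖ + ‖w'‖)`. Here `K` bounds the perturbed
coefficients, and `δ` is the coefficient error times a bound for the classical solution on `[0,T]`.
A Gronwall argument for `‖w‖² + ‖w'‖² + ‖L^{s/2} w‖²` then has constants independent of `ε` once `ε`
is small (`energy_estimate`, `IsSolution.norm_sub_sq_le`).

The equation cannot be tested with `w'`, which is only in `L²`. It is therefore projected onto
finitely many eigenspaces, where `L^{s/2}` is bounded and the energy can be differentiated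
(`exists_hasDerivWithinAt_energy`). The bound for `g` still involves the full `w` and `w'`, so the
truncated inequalities do not close one by one. A weighted maximum of the full quantity is inserted
on the right, the truncation is removed, and half of that maximum is absorbed.

The truncation needs the eigenprojections of `L` to resolve the identity. This comes from the
spectral theorem for the compact self-adjoint inverse of `L`, built from the explicit Green operator
and the Fredholm alternative (`exists_resolvent`, `resolution_spectralProj`). The eigenvalues are
bounded below by a positive number, so convergence of the initial data in `W^s_L` implies
convergence in `L²` (`exists_norm_le_normW`). -/

theorem isCompactOperator_of_summable_norm_sq {ι E F : Type*}
    [NormedAddCommGroup E] [InnerProductSpace ℂ E] [CompleteSpace E]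
    [NormedAddCommGroup F] [InnerProductSpace ℂ F] [CompleteSpace F]
    (e : HilbertBasis ι ℂ E) (A : E →L[ℂ] F) (hA : Summable fun i => ‖A (e i)‖ ^ 2) :
    IsCompactOperator A := by
  classical
  let B : Finset ι → E →L[ℂ] F := fun s =>
    ∑ i ∈ s, (innerSL ℂ (e i)).smulRight (A (e i))
  have hB (s : Finset ι) (x : E) : B s x = ∑ i ∈ s, (inner ℂ (e i) x : ℂ) • A (e i) := by
    simp [B]
  have hcomp (s : Finset ι) : IsCompactOperator (B s) := by
    have : B s ∈ compactOperator (RingHom.id ℂ) E F := by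
      refine Submodule.sum_mem _ fun i _ => ?_
      change IsCompactOperator _
      have h1 : IsCompactOperator (innerSL ℂ (e i) : E →L[ℂ] ℂ) :=
        isCompactOperator_of_locallyCompactSpace_dom (innerSL ℂ (e i) : E →L[ℂ] ℂ)
      exact h1.clm_comp (ContinuousLinearMap.toSpanSingleton ℂ (A (e i)))
    exact this
  have hsum (x : E) : Tendsto (fun s => B s x) atTop (𝓝 (A x)) := by
    have h1 : HasSum (fun i => (inner ℂ (e i) x : ℂ) • A (e i)) (A x) := by
      have := (e.hasSum_repr x).mapL A
      simpa [e.repr_apply_apply] using this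
    simp only [hB]
    exact h1
  refine isCompactOperator_of_tendsto (l := atTop) (F := B) (f := A) ?_
    (Eventually.of_forall hcomp)
  rw [Metric.tendsto_atTop]
  intro ε hε
  obtain ⟨s, hs⟩ := (summable_iff_vanishing_norm.1 hA) ((ε / 2) ^ 2) (by positivity)
  refine ⟨s, fun t ht => ?_⟩
  rw [dist_comm, dist_eq_norm]
  refine lt_of_le_of_lt (ContinuousLinearMap.opNorm_le_bound _ (M := ε / 2) (by positivity)
    fun x => ?_) (by linarith)
  -- `A - B t` is the pointwise limit of `B r - B t`, a finite sum over `r \ t`. Cauchy-Schwarz and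
  -- Bessel bound that sum by the tail of `∑ ‖A eᵢ‖²`, uniformly in `r`.
  have hlim : Tendsto (fun r => ‖(B r - B t) x‖) atTop (𝓝 ‖(A - B t) x‖) := by
    simp only [sub_apply]
    exact ((hsum x).sub_const _).norm
  refine le_of_tendsto hlim ?_
  filter_upwards [eventually_ge_atTop t] with r hr
  have hdiff : (B r - B t) x = ∑ i ∈ r \ t, (inner ℂ (e i) x : ℂ) • A (e i) := by
    simp only [sub_apply, hB]
    rw [← Finset.sum_sdiff hr]
    abel
  rw [hdiff]
  have h2 : ∑ i ∈ r \ t, ‖A (e i)‖ ^ 2 ≤ (ε / 2) ^ 2 := by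
    have := hs (r \ t) (Finset.disjoint_of_subset_right ht Finset.sdiff_disjoint)
    exact (le_abs_self _).trans this.le
  have h3 : ∑ i ∈ r \ t, ‖(inner ℂ (e i) x : ℂ)‖ ^ 2 ≤ ‖x‖ ^ 2 :=
    e.orthonormal.sum_inner_products_le x
  calc _ ≤ ∑ i ∈ r \ t, ‖(inner ℂ (e i) x : ℂ)‖ * ‖A (e i)‖ := by
        refine (norm_sum_le _ _).trans (le_of_eq ?_)
        simp [norm_smul]
    _ ≤ √(∑ i ∈ r \ t, ‖(inner ℂ (e i) x : ℂ)‖ ^ 2) * √(∑ i ∈ r \ t, ‖A (e i)‖ ^ 2) :=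
        Real.sum_mul_le_sqrt_mul_sqrt _ _ _
    _ ≤ √(‖x‖ ^ 2) * √((ε / 2) ^ 2) := by gcongr
    _ = ε / 2 * ‖x‖ := by
        rw [Real.sqrt_sq (norm_nonneg _), Real.sqrt_sq (by positivity), mul_comm]

/-- An operator into `L²` whose values are given pointwise by pairing with vectors of bounded norm
is Hilbert-Schmidt, hence compact. -/
theorem isCompactOperator_of_kernel (A : L2 →L[ℂ] L2) (k : ℝ → L2) {C : ℝ}
    (hk : ∀ x, ‖k x‖ ≤ C)
    (hA : ∀ g : L2, A g =ᵐ[unitMeasure] fun x => (inner ℂ (k x) g : ℂ)) :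
    IsCompactOperator A := by
  obtain ⟨w, e, -⟩ := exists_hilbertBasis ℂ L2
  refine isCompactOperator_of_summable_norm_sq e A
    (summable_of_sum_le (c := C ^ 2) (fun i => by positivity) fun s => ?_)
  have hnorm (g : L2) : ‖g‖ ^ 2 = ∫ x, ‖g x‖ ^ 2 ∂unitMeasure := by
    have h1 : (inner ℂ g g : ℂ) = ∫ x, ((‖g x‖ ^ 2 : ℝ) : ℂ) ∂unitMeasure := by
      rw [L2.inner_def]
      refine integral_congr_ae (Eventually.of_forall fun x => ?_)
      simp only [inner_self_eq_norm_sq_to_K]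
      simp
    rw [inner_self_eq_norm_sq_to_K, integral_complex_ofReal] at h1
    rw [← RCLike.ofReal_pow] at h1
    exact Complex.ofReal_injective h1
  have hint (g : L2) : Integrable (fun x => ‖g x‖ ^ 2) unitMeasure :=
    (Lp.memLp g).integrable_norm_pow (by norm_num)
  simp_rw [hnorm]
  rw [← integral_finsetSum _ fun i _ => hint _]
  -- Bessel's inequality for the single vector `k x`, at almost every `x`. Integrating it bounds
  -- every finite part of the Hilbert-Schmidt sum.
  have hae : ∀ᵐ x ∂unitMeasure, ∑ i ∈ s, ‖A (e i) x‖ ^ 2 ≤ C ^ 2 := by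
    have hall : ∀ᵐ x ∂unitMeasure, ∀ i ∈ s, A (e i) x = (inner ℂ (k x) (e i) : ℂ) :=
      (Finset.eventually_all s).2 fun i _ => hA (e i)
    filter_upwards [hall] with x hx
    calc ∑ i ∈ s, ‖A (e i) x‖ ^ 2 = ∑ i ∈ s, ‖(inner ℂ (e i) (k x) : ℂ)‖ ^ 2 :=
          Finset.sum_congr rfl fun i hi => by rw [hx i hi, norm_inner_symm]
      _ ≤ ‖k x‖ ^ 2 := e.orthonormal.sum_inner_products_le _
      _ ≤ C ^ 2 := by gcongr; exact hk x
  calc _ ≤ ∫ _, C ^ 2 ∂unitMeasure :=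
        integral_mono_ae (integrable_finsetSum _ fun i _ => hint _) (integrable_const _) hae
    _ = C ^ 2 := by simp

/-! ### The Volterra operator -/

/-- The characteristic function of `(0,x)`. -/
def indicatorBelow (x : ℝ) : L2 :=
  indicatorConstLp 2 (measurableSet_Iio (a := x)) (measure_ne_top unitMeasure _) (1 : ℂ)

/-- The constant function `1`. -/
def one : L2 := indicatorConstLp 2 MeasurableSet.univ (measure_ne_top unitMeasure _) (1 : ℂ)

theorem norm_indicatorBelow_le (x : ℝ) : ‖indicatorBelow x‖ ≤ 1 := by
  rw [indicatorBelow, norm_indicatorConstLp (by norm_num) (by norm_num), norm_one, one_mul]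
  refine Real.rpow_le_one (by positivity) ?_ (by norm_num)
  exact (measureReal_mono (subset_univ _)).trans (by simp [measureReal_def])

theorem inner_one (g : L2) : (inner ℂ one g : ℂ) = ∫ t, g t ∂unitMeasure := by
  rw [one, L2.inner_indicatorConstLp_one, setIntegral_univ]

theorem coeFn_one : (one : L2) =ᵐ[unitMeasure] fun _ => (1 : ℂ) := by
  filter_upwards [indicatorConstLp_coeFn (p := 2) (hs := MeasurableSet.univ)
    (hμs := measure_ne_top unitMeasure univ) (c := (1 : ℂ))] with x hx
  rw [one, hx]; simp

/-- The primitive of `g ∈ L²(0,1)` that vanishes at `0`. -/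
def primitive (g : L2) (x : ℝ) : ℂ := ∫ t in Ioo 0 x, g t

theorem inner_indicatorBelow (g : L2) {x : ℝ} (hx : x ≤ 1) :
    (inner ℂ (indicatorBelow x) g : ℂ) = primitive g x := by
  rw [indicatorBelow, L2.inner_indicatorConstLp_one, primitive,
    Measure.restrict_restrict measurableSet_Iio]
  congr 2
  ext t
  simp only [mem_inter_iff, mem_Iio, mem_Ioo]
  constructor
  · rintro ⟨h1, h2, -⟩; exact ⟨h2, h1⟩
  · rintro ⟨h1, h2⟩; exact ⟨h2, h1, h2.trans_le hx⟩

theorem primitive_zero (g : L2) : primitive g 0 = 0 := by simp [primitive]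

theorem primitive_one (g : L2) : primitive g 1 = inner ℂ one g := by
  rw [inner_one, primitive]

theorem primitive_eq_intervalIntegral (g : L2) {x : ℝ} (hx : 0 ≤ x) :
    primitive g x = ∫ t in (0 : ℝ)..x, g t := by
  rw [primitive, intervalIntegral.integral_of_le hx, integral_Ioc_eq_integral_Ioo]

theorem continuousOn_primitive (g : L2) : ContinuousOn (primitive g) (Icc 0 1) := by
  have h : IntegrableOn (fun t => g t) (Icc 0 1) := by
    rw [integrableOn_Icc_iff_integrableOn_Ioo]
    exact integrableOn_L2 g le_rfl
  rw [← uIcc_of_le zero_le_one] at h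
  have h1 := intervalIntegral.continuousOn_primitive_interval h
  rw [uIcc_of_le zero_le_one] at h1
  exact h1.congr fun x hx => primitive_eq_intervalIntegral g hx.1

theorem norm_primitive_le (g : L2) {x : ℝ} (hx : x ≤ 1) : ‖primitive g x‖ ≤ ‖g‖ := by
  rw [← inner_indicatorBelow g hx]
  refine (norm_inner_le_norm _ _).trans ?_
  exact mul_le_of_le_one_left (norm_nonneg _) (norm_indicatorBelow_le x)

/-- A function continuous on `[0,1]` is in `L²(0,1)`. -/
theorem memLp_of_continuousOn {y : ℝ → ℂ} (hy : ContinuousOn y (Icc 0 1)) :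
    MemLp y 2 unitMeasure := by
  obtain ⟨C, hC⟩ := isCompact_Icc.exists_bound_of_continuousOn hy
  refine MemLp.of_bound
    ((hy.mono Ioo_subset_Icc_self).aestronglyMeasurable measurableSet_Ioo) C ?_
  filter_upwards [ae_restrict_mem measurableSet_Ioo] with x hx
  exact hC x (Ioo_subset_Icc_self hx)

/-- The Volterra operator `g ↦ ∫₀ˣ g`. -/
def volterra : L2 →L[ℂ] L2 :=
  LinearMap.mkContinuous
    { toFun := fun g => (memLp_of_continuousOn (continuousOn_primitive g)).toLp
      map_add' := fun f g => by
        rw [← MemLp.toLp_add]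
        refine MemLp.toLp_congr _ _ ?_
        filter_upwards [ae_restrict_mem measurableSet_Ioo] with x hx
        simp only [Pi.add_apply, ← inner_indicatorBelow _ hx.2.le, inner_add_right]
      map_smul' := fun c g => by
        rw [RingHom.id_apply, ← MemLp.toLp_const_smul]
        refine MemLp.toLp_congr _ _ ?_
        filter_upwards [ae_restrict_mem measurableSet_Ioo] with x hx
        simp only [Pi.smul_apply, ← inner_indicatorBelow _ hx.2.le, inner_smul_right,
          smul_eq_mul] } 1 fun g => by
    refine (Lp.norm_le_of_ae_bound (norm_nonneg g) ?_).trans (le_of_eq (b := 1 * ‖g‖) ?_)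
    · filter_upwards [MemLp.coeFn_toLp (memLp_of_continuousOn (continuousOn_primitive g)),
        ae_restrict_mem measurableSet_Ioo] with x hx h1
      change ‖((memLp_of_continuousOn (continuousOn_primitive g)).toLp : L2) x‖ ≤ _
      rw [hx]
      exact norm_primitive_le g h1.2.le
    · simp [measureUnivNNReal]

theorem coeFn_volterra (g : L2) : volterra g =ᵐ[unitMeasure] primitive g :=
  MemLp.coeFn_toLp (memLp_of_continuousOn (continuousOn_primitive g))

theorem isCompactOperator_volterra : IsCompactOperator volterra := by
  refine isCompactOperator_of_kernel volterra indicatorBelow norm_indicatorBelow_le fun g => ?_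
  filter_upwards [coeFn_volterra g, ae_restrict_mem measurableSet_Ioo] with x hx h1
  rw [hx, inner_indicatorBelow g h1.2.le]

/-- Integration by parts for primitives of square-integrable functions. -/
theorem inner_volterra_add (f g : L2) :
    (inner ℂ f (volterra g) : ℂ) + inner ℂ (volterra f) g = inner ℂ f one * inner ℂ one g := by
  have hf : Integrable (fun t => (starRingEnd ℂ) (f t)) unitMeasure :=
    (Complex.conjCLE : ℂ →L[ℝ] ℂ).integrable_comp ((Lp.memLp f).integrable (by norm_num))
  have hg : Integrable (fun t => g t) unitMeasure := (Lp.memLp g).integrable (by norm_num)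
  -- Fubini on the two triangles of the unit square: each carries one of the inner products, and
  -- together they give the product integral. The complement of `S` contains the diagonal, so below
  -- `Iio` is exchanged for `Iic` up to a null set.
  let S : Set (ℝ × ℝ) := {p | p.2 < p.1}
  have hS : MeasurableSet S := measurableSet_lt measurable_snd measurable_fst
  let H : ℝ × ℝ → ℂ := fun p => (starRingEnd ℂ) (f p.1) * g p.2
  have hH : Integrable H (unitMeasure.prod unitMeasure) := hf.mul_prod hg
  have h1 : ∫ p in S, H p ∂(unitMeasure.prod unitMeasure) = inner ℂ f (volterra g) := by
    rw [← integral_indicator hS, integral_prod _ (hH.indicator hS), L2.inner_def]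
    refine integral_congr_ae ?_
    filter_upwards [coeFn_volterra g, ae_restrict_mem measurableSet_Ioo] with s hs hs1
    rw [hs, ← inner_indicatorBelow g hs1.2.le, indicatorBelow, L2.inner_indicatorConstLp_one,
      RCLike.inner_apply, mul_comm, ← integral_const_mul, ← integral_indicator measurableSet_Iio]
    rfl
  have h2 : ∫ p in Sᶜ, H p ∂(unitMeasure.prod unitMeasure) = inner ℂ (volterra f) g := by
    rw [← integral_indicator hS.compl, integral_prod_symm _ (hH.indicator hS.compl), L2.inner_def]
    refine integral_congr_ae ?_
    filter_upwards [coeFn_volterra f, ae_restrict_mem measurableSet_Ioo] with t ht ht1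
    rw [ht, ← inner_indicatorBelow f ht1.2.le, indicatorBelow, L2.inner_indicatorConstLp_one,
      RCLike.inner_apply, mul_comm, ← integral_conj, ← integral_mul_const,
      ← integral_indicator measurableSet_Iio, integral_indicator measurableSet_Iio,
      ← setIntegral_congr_set (Iio_ae_eq_Iic (μ := unitMeasure) (a := t)).symm,
      ← integral_indicator measurableSet_Iic]
    refine integral_congr_ae (Eventually.of_forall fun s => ?_)
    by_cases h : s ≤ t
    · have h' : (s, t) ∈ Sᶜ := not_lt.2 h
      simp [indicator_of_mem, h, h', H]
    · have h' : (s, t) ∉ Sᶜ := fun h' => h (not_lt.1 h')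
      simp [h, indicator_of_notMem h']
  rw [← h1, ← h2, integral_add_compl hS hH, integral_prod_mul (fun t => (starRingEnd ℂ) (f t)) g,
    inner_one, ← inner_conj_symm f one, inner_one, integral_conj]

theorem inner_one_one : (inner ℂ one one : ℂ) = 1 := by
  rw [inner_one, integral_congr_ae coeFn_one]; simp

/-- A primitive is continuous, so being constant almost everywhere makes it constant on `(0,1)`;
Lebesgue differentiation recovers `g` as its derivative. The injectivity of `green` rests on this.
-/
theorem eq_zero_of_volterra_eq_const {g : L2} {c : ℂ} (h : volterra g = c • one) : g = 0 := by
  have h1 : primitive g =ᵐ[unitMeasure] fun _ => c := by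
    filter_upwards [coeFn_volterra g, Lp.coeFn_smul c one, coeFn_one] with x h2 h3 h4
    rw [← h2, h, h3, Pi.smul_apply, h4, smul_eq_mul, mul_one]
  have h2 : EqOn (primitive g) (fun _ => c) (Ioo 0 1) :=
    Measure.eqOn_open_of_ae_eq h1 isOpen_Ioo
      ((continuousOn_primitive g).mono Ioo_subset_Icc_self) continuousOn_const
  have hint : IntervalIntegrable (fun t => g t) volume 0 1 := by
    rw [intervalIntegrable_iff_integrableOn_Ioo_of_le zero_le_one]
    exact integrableOn_L2 g le_rfl
  have h3 := hint.ae_hasDerivAt_integral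
  apply Lp.ext
  filter_upwards [ae_restrict_of_ae h3, ae_restrict_mem measurableSet_Ioo,
    Lp.coeFn_zero ℂ 2 unitMeasure] with x hx hx1 h0
  rw [h0]
  have hx2 : x ∈ uIcc (0 : ℝ) 1 := by
    rw [uIcc_of_le zero_le_one]; exact Ioo_subset_Icc_self hx1
  refine (hx hx2 0 (by simp)).unique ((hasDerivAt_const x c).congr_of_eventuallyEq ?_)
  filter_upwards [isOpen_Ioo.mem_nhds hx1] with t ht
  rw [← primitive_eq_intervalIntegral g ht.1.le, h2 ht]

theorem inner_volterra_right (f g : L2) :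
    (inner ℂ f (volterra g) : ℂ) = inner ℂ f one * inner ℂ one g - inner ℂ (volterra f) g :=
  eq_sub_of_add_eq (inner_volterra_add f g)

/-! ### The Dirichlet Green operator and the inverse of `L` -/

/-- The inverse of `-d²/dx²` with Dirichlet boundary conditions. -/
def green : L2 →L[ℂ] L2 :=
  volterra ∘L ((innerSL ℂ one).smulRight one - ContinuousLinearMap.id ℂ L2) ∘L volterra

/-- Integrating `-y'' = g` once gives `y' = c - ∫₀ˣ g`, and again, with `y(0) = 0`, gives `y`. Since
`y(1)` is the mean of `y'`, the condition `y(1) = 0` forces `c` to be the mean of the primitive of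
`g`. -/
theorem green_apply (g : L2) :
    green g = volterra ((inner ℂ one (volterra g) : ℂ) • one - volterra g) := by
  simp [green]

theorem isCompactOperator_green : IsCompactOperator green :=
  isCompactOperator_volterra.comp_clm
    (((innerSL ℂ one).smulRight one - ContinuousLinearMap.id ℂ L2) ∘L volterra)

/-- Integration by parts on the outer Volterra factor produces a form that is visibly Hermitian in
`f` and `g`, whence the symmetry of `green`. -/
theorem inner_green_right (f g : L2) :
    (inner ℂ f (green g) : ℂ) = inner ℂ (volterra f) (volterra g)
      - inner ℂ (volterra f) one * inner ℂ one (volterra g) := by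
  rw [green_apply, inner_volterra_right, inner_sub_right, inner_sub_right, inner_smul_right,
    inner_smul_right, inner_one_one]
  ring

theorem inner_green_left (f g : L2) : (inner ℂ (green f) g : ℂ) = inner ℂ f (green g) := by
  rw [← inner_conj_symm, inner_green_right, inner_green_right]
  simp only [map_sub, map_mul, inner_conj_symm]
  ring

theorem eq_zero_of_green_eq_zero {g : L2} (h : green g = 0) : g = 0 := by
  rw [green_apply] at h
  have h1 := eq_zero_of_volterra_eq_const (c := 0) (by rw [h, zero_smul])
  exact eq_zero_of_volterra_eq_const (sub_eq_zero.1 h1).symm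

/-- The potential is moved to the right-hand side, so the boundary value problem becomes an equation
between bounded operators on `L²`, accessible to Fredholm theory. -/
theorem mem_graph_iff (q : LInf) (f g : L2) :
    (f, g) ∈ graph q ↔ f = green (g - (q • f : L2)) := by
  constructor
  · rintro ⟨y, v, hy, h0, h1, hd, hv⟩
    dsimp only at hv hy
    set h : L2 := q • f - g with hh
    have hvc : ContinuousOn v (Icc 0 1) :=
      (continuousOn_const.add (continuousOn_primitive h)).congr hv
    -- The class of `y'` in `L²`, so that `y` is the primitive of `w`.
    let w : L2 := v 0 • one + volterra h
    have hw : w =ᵐ[unitMeasure] v := by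
      filter_upwards [Lp.coeFn_add (v 0 • one) (volterra h), Lp.coeFn_smul (v 0) one, coeFn_one,
        coeFn_volterra h, ae_restrict_mem measurableSet_Ioo] with x e1 e2 e3 e4 e5
      rw [e1, Pi.add_apply, e2, Pi.smul_apply, e3, e4, hv x (Ioo_subset_Icc_self e5)]
      simp [primitive]
    have hyw : ∀ x ∈ Icc (0 : ℝ) 1, y x = primitive w x := by
      intro x hx
      have hsub : Icc 0 x ⊆ Icc (0 : ℝ) 1 := Icc_subset_Icc_right hx.2
      have e1 : ∫ t in (0 : ℝ)..x, v t = y x - y 0 := by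
        refine intervalIntegral.integral_eq_sub_of_hasDerivAt_of_le hx.1
          (fun t ht => ((hd t (hsub ht)).continuousWithinAt).mono hsub) (fun t ht => ?_) ?_
        · exact (hd t (hsub (Ioo_subset_Icc_self ht))).hasDerivAt
            (Icc_mem_nhds ht.1 (ht.2.trans_le hx.2))
        · exact ContinuousOn.intervalIntegrable (by rw [uIcc_of_le hx.1]; exact hvc.mono hsub)
      rw [h0, sub_zero, intervalIntegral.integral_of_le hx.1, integral_Ioc_eq_integral_Ioo] at e1
      rw [← e1, primitive]
      exact (integral_congr_ae (ae_Ioo hw hx.2)).symm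
    have hf : f = volterra w := by
      apply Lp.ext
      filter_upwards [hy, coeFn_volterra w, ae_restrict_mem measurableSet_Ioo] with x e1 e2 e3
      rw [e1, e2, hyw x (Ioo_subset_Icc_self e3)]
    -- The condition `y(1) = 0` fixes the free constant `y'(0)`.
    have hc : v 0 + inner ℂ one (volterra h) = 0 := by
      have := hyw 1 (by simp)
      rw [h1, primitive_one, inner_add_right, inner_smul_right, inner_one_one, mul_one] at this
      exact this.symm
    have hneg : g - (q • f : L2) = -h := by rw [hh]; abel
    rw [hneg, green_apply, map_neg, inner_neg_right, ← eq_neg_of_add_eq_zero_left hc, hf]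
    simp [w]
  · intro hf
    -- The sign of `h` is opposite to that in the first half, so here `y' = c - ∫₀ˣ h`.
    set h : L2 := g - (q • f : L2) with hh
    let c : ℂ := inner ℂ one (volterra h)
    let v : ℝ → ℂ := fun x => c - primitive h x
    have hvc : ContinuousOn v (Icc 0 1) := continuousOn_const.sub (continuousOn_primitive h)
    let w : L2 := c • one - volterra h
    have hw : w =ᵐ[unitMeasure] v := by
      filter_upwards [Lp.coeFn_sub (c • one) (volterra h), Lp.coeFn_smul c one, coeFn_one,
        coeFn_volterra h] with x e1 e2 e3 e4
      rw [e1, Pi.sub_apply, e2, Pi.smul_apply, e3, e4]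
      simp [v]
    have hvi : IntervalIntegrable v volume 0 1 :=
      ContinuousOn.intervalIntegrable (by rwa [uIcc_of_le zero_le_one])
    have hy : ∀ x ∈ Icc (0 : ℝ) 1, ∫ t in (0 : ℝ)..x, v t = primitive w x := by
      intro x hx
      rw [intervalIntegral.integral_of_le hx.1, integral_Ioc_eq_integral_Ioo, primitive]
      exact (integral_congr_ae (ae_Ioo hw hx.2)).symm
    refine ⟨fun x => ∫ t in (0 : ℝ)..x, v t, v, ?_, by simp, ?_, fun x hx => ?_, fun x hx => ?_⟩
    · filter_upwards [coeFn_volterra w, ae_restrict_mem measurableSet_Ioo] with x e1 e2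
      rw [hy x (Ioo_subset_Icc_self e2), ← e1]
      rw [hf, green_apply]
    · change ∫ t in (0 : ℝ)..1, v t = 0
      rw [hy 1 (by simp), primitive_one, inner_sub_right, inner_smul_right, inner_one_one]
      simp [c]
    · have : Fact (x ∈ Icc (0 : ℝ) 1) := ⟨hx⟩
      refine intervalIntegral.integral_hasDerivWithinAt_right ?_ ?_ (hvc x hx)
      · exact hvi.mono_set (by rw [uIcc_of_le hx.1, uIcc_of_le zero_le_one]
                               exact Icc_subset_Icc_right hx.2)
      · exact hvc.stronglyMeasurableAtFilter_nhdsWithin measurableSet_Icc x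
    · have e : (q • (f, g).1 - (f, g).2 : L2) = -h := by rw [hh]; simp
      rw [e, ← primitive, ← inner_indicatorBelow _ hx.2, inner_neg_right,
        inner_indicatorBelow _ hx.2]
      simp [v, primitive_zero, sub_eq_add_neg]

/-- Multiplication by a bounded function. -/
def mulOp (q : LInf) : L2 →L[ℂ] L2 :=
  LinearMap.mkContinuous
    { toFun := fun f => (q • f : L2)
      map_add' := fun f g => Lp.add_smul q f g
      map_smul' := fun c f => smul_mul_L2 q c f } ‖q‖ fun f => Lp.norm_smul_le q f

theorem inner_mul_left (q : LInf) (f g : L2) :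
    (inner ℂ (q • f : L2) g : ℂ) = inner ℂ f (q • g : L2) := by
  rw [L2.inner_def, L2.inner_def]
  refine integral_congr_ae ?_
  filter_upwards [Lp.coeFn_lpSMul (r := 2) q f, Lp.coeFn_lpSMul (r := 2) q g] with x h1 h2
  rw [h1, h2]
  simp
  ring

theorem mem_eigenspace_iff (q : LInf) (lam : ℝ) (f : L2) :
    f ∈ eigenspace q lam ↔ (f, (lam : ℂ) • f) ∈ graph q := Iff.rfl

/-- If `0` is not an eigenvalue then `L` has a compact self-adjoint inverse. -/
theorem exists_resolvent (q : LInf) (h0 : ¬ IsEigenvalue q 0) :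
    ∃ R : L2 →L[ℂ] L2, IsCompactOperator R ∧ R.IsSymmetric ∧
      ∀ f g : L2, (f, g) ∈ graph q ↔ f = R g := by
  -- `L f = g` reads `(1 - K) f = green g`. A fixed vector of the compact operator `K` lies in the
  -- eigenspace of `L` for `0`, so by the Fredholm alternative `1 - K` is invertible.
  let K : L2 →L[ℂ] L2 := -(green ∘L mulOp q)
  have hK : IsCompactOperator K := (isCompactOperator_green.comp_clm (mulOp q)).neg
  have hKf (f : L2) : K f = -green (q • f : L2) := rfl
  have h1 : ¬ Module.End.HasEigenvalue (K : Module.End ℂ L2) 1 := by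
    intro h
    obtain ⟨f, hf⟩ := h.exists_hasEigenvector
    apply hf.2
    have h2 : K f = f := by simpa using hf.apply_eq_smul
    have h3 : f ∈ eigenspace q 0 := by
      rw [mem_eigenspace_iff, mem_graph_iff]
      rw [hKf] at h2
      simp [h2]
    rw [IsEigenvalue, not_not] at h0
    rwa [h0, Submodule.mem_bot] at h3
  have h2 : IsUnit ((1 : L2 →L[ℂ] L2) - K) := by
    have := (hK.hasEigenvalue_or_mem_resolventSet one_ne_zero).resolve_left h1
    simpa [spectrum.mem_resolventSet_iff] using this
  obtain ⟨U, hU⟩ := h2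
  have hinv (f : L2) : (U⁻¹.1 : L2 →L[ℂ] L2) (f - K f) = f := by
    have := congrArg (fun B : L2 →L[ℂ] L2 => B f) U.inv_mul
    rw [hU] at this
    simpa using this
  have hinv' (f : L2) : U⁻¹.1 f - K (U⁻¹.1 f) = f := by
    have := congrArg (fun B : L2 →L[ℂ] L2 => B f) U.mul_inv
    rw [hU] at this
    simpa using this
  let R : L2 →L[ℂ] L2 := U⁻¹.1 ∘L green
  have hR : ∀ f g : L2, (f, g) ∈ graph q ↔ f = R g := by
    intro f g
    rw [mem_graph_iff, map_sub]
    have e : f = green g - green (q • f : L2) ↔ f - K f = green g := by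
      rw [hKf, sub_neg_eq_add, eq_sub_iff_add_eq]
    rw [e]
    constructor
    · intro h; rw [← hinv f, h]; rfl
    · intro h; rw [h]; exact hinv' _
  refine ⟨R, isCompactOperator_green.clm_comp U⁻¹.1, ?_, hR⟩
  intro g h
  change (inner ℂ (R g) h : ℂ) = inner ℂ g (R h)
  have hg : R g = green (g - (q • R g : L2)) := (mem_graph_iff q _ _).1 ((hR _ _).2 rfl)
  have hh : R h = green (h - (q • R h : L2)) := (mem_graph_iff q _ _).1 ((hR _ _).2 rfl)
  -- Symmetry of `green`, applied to the equations for `R g` and `R h`. The two terms with `q`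
  -- cancel because multiplication by a real function is symmetric.
  have e1 : (inner ℂ (R g) (h - (q • R h : L2)) : ℂ) = inner ℂ (g - (q • R g : L2)) (R h) := by
    conv_lhs => rw [hg, inner_green_left, ← hh]
  rw [inner_sub_right, inner_sub_left, inner_mul_left] at e1
  exact sub_left_injective e1

/-! ### Spectral decomposition -/

/-- The family of orthogonal projections `P i` resolves the identity. -/
structure IsResolution {ι H : Type*} [NormedAddCommGroup H] [InnerProductSpace ℂ H]
    (P : ι → H →L[ℂ] H) : Prop where
  idem : ∀ i x, P i (P i x) = P i x
  ortho : ∀ i j, i ≠ j → ∀ x, P i (P j x) = 0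
  symm : ∀ i x y, (inner ℂ (P i x) y : ℂ) = inner ℂ x (P i y)
  hasSum : ∀ x, HasSum (fun i => P i x) x

/-- Orthogonality and density make the subspaces a Hilbert sum. The components in the resulting
expansion of `x` are its projections, since each projection annihilates all other summands. -/
theorem isResolution_starProjection {ι H : Type*} [NormedAddCommGroup H] [InnerProductSpace ℂ H]
    [CompleteSpace H] (V : ι → Submodule ℂ H) [∀ i, CompleteSpace (V i)]
    (hV : OrthogonalFamily ℂ (fun i => V i) fun i => (V i).subtypeₗᵢ)
    (hd : (⨆ i, V i)ᗮ = ⊥) : IsResolution fun i => (V i).starProjection := by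
  classical
  have hort : ∀ i j, i ≠ j → ∀ x ∈ V j, (V i).starProjection x = 0 := by
    intro i j hij x hx
    rw [Submodule.starProjection_apply_eq_zero_iff]
    exact fun y hy => hV.isOrtho hij |>.inner_eq hy hx
  refine ⟨fun i x => ?_, fun i j hij x => ?_, fun i x y => ?_, fun x => ?_⟩
  · exact Submodule.starProjection_eq_self_iff.2 (Submodule.starProjection_apply_mem _ _)
  · exact hort i j hij _ (Submodule.starProjection_apply_mem _ _)
  · exact Submodule.inner_starProjection_left_eq_right _ _ _
  · have hS : IsHilbertSum ℂ (fun i => V i) fun i => (V i).subtypeₗᵢ :=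
      IsHilbertSum.mkInternal V hV
        (by rw [Submodule.topologicalClosure_eq_top_iff.2 hd])
    obtain ⟨w, hw⟩ := hS.surjective_isometry x
    have h1 : HasSum (fun i => ((w i : V i) : H)) x := by
      rw [← hw]; exact hS.OrthogonalFamily.hasSum_linearIsometry w
    have h2 : ∀ i, (V i).starProjection x = w i := by
      intro i
      have h3 := h1.mapL (V i).starProjection
      refine h3.unique ?_
      convert! hasSum_ite_eq i ((w i : V i) : H) using 2 with j
      split_ifs with h
      · subst h; exact Submodule.starProjection_eq_self_iff.2 (w j).2
      · exact hort i j (Ne.symm h) _ (w j).2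
    simpa only [h2] using h1

/-- For `lam ≠ 0` the eigenspace of `L` is the eigenspace of its compact symmetric inverse `R` for
`lam⁻¹`, so the spectral theorem for `R` applies. An eigenvector satisfies `f = lam R f`, which
keeps positive eigenvalues away from `0`. -/
theorem resolution_spectralProj (q : LInf) (hq : ∀ lam : ℝ, IsEigenvalue q lam → 0 < lam) :
    IsResolution (spectralProj q) ∧
      ∃ m : ℝ, 0 < m ∧ ∀ lam, lam < m → spectralProj q lam = 0 := by
  obtain ⟨R, hRc, hRs, hR⟩ := exists_resolvent q fun h => lt_irrefl _ (hq 0 h)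
  have hE : ∀ lam : ℝ, lam ≠ 0 →
      eigenspace q lam = Module.End.eigenspace (R : Module.End ℂ L2) ((lam⁻¹ : ℝ) : ℂ) := by
    intro lam hlam
    have hlam' : (lam : ℂ) ≠ 0 := by exact_mod_cast hlam
    ext f
    rw [mem_eigenspace_iff, hR, Module.End.mem_eigenspace_iff, map_smul]
    push_cast
    rw [eq_inv_smul_iff₀ hlam', eq_comm]
  have hbot : ∀ lam : ℝ, lam ≤ 0 → eigenspace q lam = ⊥ := fun lam hlam => by
    by_contra h
    exact absurd (hq lam h) (not_lt.2 hlam)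
  have hclosed : ∀ lam, (eigenspace q lam).topologicalClosure = eigenspace q lam := by
    intro lam
    apply IsClosed.submodule_topologicalClosure_eq
    rcases le_or_gt lam 0 with h | h
    · rw [hbot lam h]; exact isClosed_singleton
    · have : (eigenspace q lam : Set L2) = {f | R f = ((lam⁻¹ : ℝ) : ℂ) • f} := by
        rw [hE lam h.ne']; ext f; simp
      rw [this]
      exact isClosed_eq R.continuous (continuous_const_smul _)
  have hfam : OrthogonalFamily ℂ (fun lam => (eigenspace q lam).topologicalClosure)
      fun lam => ((eigenspace q lam).topologicalClosure).subtypeₗᵢ := by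
    refine OrthogonalFamily.of_pairwise fun l l' hll => ?_
    simp only [hclosed, Function.onFun]
    rcases le_or_gt l 0 with h | h
    · rw [hbot l h]; exact Submodule.isOrtho_bot_left
    rcases le_or_gt l' 0 with h' | h'
    · rw [hbot l' h']; exact Submodule.isOrtho_bot_right
    rw [hE l h.ne', hE l' h'.ne']
    refine hRs.orthogonalFamily_eigenspaces.isOrtho fun e => hll ?_
    exact inv_injective (Complex.ofReal_injective e)
  have hdense : (⨆ lam, (eigenspace q lam).topologicalClosure)ᗮ = ⊥ := by
    rw [eq_bot_iff, ← ContinuousLinearMap.orthogonalComplement_iSup_eigenspaces_eq_bot hRc hRs]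
    refine Submodule.orthogonal_le (iSup_le fun μ => ?_)
    by_cases hμ : Module.End.HasEigenvalue (R : Module.End ℂ L2) μ
    · have hconj := hRs.conj_eigenvalue_eq_self hμ
      obtain ⟨r, rfl⟩ := Complex.conj_eq_iff_real.1 hconj
      -- `R` is injective: `R f = 0` puts `(0, f)` in the graph, that is, `green f = 0`.
      have hr : r ≠ 0 := by
        rintro rfl
        obtain ⟨f, hf⟩ := hμ.exists_hasEigenvector
        apply hf.2
        have h1 : R f = 0 := by simpa using hf.apply_eq_smul
        have h2 := (mem_graph_iff q _ _).1 ((hR 0 f).2 h1.symm)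
        rw [Lp.smul_zero, sub_zero] at h2
        exact eq_zero_of_green_eq_zero h2.symm
      refine le_iSup_of_le r⁻¹ ?_
      rw [hclosed, hE _ (inv_ne_zero hr), inv_inv]
    · rw [Module.End.hasEigenvalue_iff, not_not] at hμ
      rw [hμ]; exact bot_le
  -- The summand `1` keeps the bound positive and meaningful without excluding `‖R‖ = 0`.
  refine ⟨isResolution_starProjection _ hfam hdense, (‖R‖ + 1)⁻¹, by positivity, ?_⟩
  intro lam hlam
  have h1 : eigenspace q lam = ⊥ := by
    rcases le_or_gt lam 0 with h | h
    · exact hbot lam h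
    rw [eq_bot_iff]
    intro f hf
    rw [mem_eigenspace_iff, hR, map_smul] at hf
    have h2 : ‖f‖ ≤ lam * (‖R‖ * ‖f‖) := by
      conv_lhs => rw [hf]
      rw [norm_smul, Complex.norm_real, Real.norm_of_nonneg h.le]
      gcongr
      exact R.le_opNorm f
    have h3 : lam * (‖R‖ + 1) < 1 := by
      rwa [lt_inv_comm₀ h (by positivity), ← one_div, lt_div_iff₀' h] at hlam
    rw [Submodule.mem_bot, ← norm_eq_zero]
    by_contra hne
    have hpos : 0 < ‖f‖ := lt_of_le_of_ne (norm_nonneg f) (Ne.symm hne)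
    nlinarith [mul_pos h hpos]
  have h2 : (eigenspace q lam).topologicalClosure = ⊥ := by rw [hclosed, h1]
  simp [h2, spectralProj]

/-! ### Finite spectral truncations -/

section Truncation

variable {ι H : Type*} [NormedAddCommGroup H] [InnerProductSpace ℂ H]

/-- The spectral multiplier with the values `c i` for `i ∈ S` and `0` elsewhere. -/
def multiplier (P : ι → H →L[ℂ] H) (c : ι → ℝ) (S : Finset ι) : H →L[ℂ] H :=
  ∑ i ∈ S, (c i : ℂ) • P i

variable {P : ι → H →L[ℂ] H}

theorem multiplier_apply (c : ι → ℝ) (S : Finset ι) (x : H) :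
    multiplier P c S x = ∑ i ∈ S, (c i : ℂ) • P i x := by
  simp [multiplier]

namespace IsResolution

variable (hP : IsResolution P)
include hP

theorem proj_multiplier [DecidableEq ι] (c : ι → ℝ) (S : Finset ι) (i : ι) (x : H) :
    P i (multiplier P c S x) = if i ∈ S then (c i : ℂ) • P i x else 0 := by
  have h : ∀ j ∈ S, P i ((c j : ℂ) • P j x) = if i = j then (c j : ℂ) • P j x else 0 := by
    intro j _
    rw [map_smul]
    split_ifs with h
    · rw [h, hP.idem]
    · rw [hP.ortho i j h, smul_zero]
  rw [multiplier_apply, map_sum, Finset.sum_congr rfl h, Finset.sum_ite_eq]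

theorem inner_multiplier_left (c : ι → ℝ) (S : Finset ι) (x y : H) :
    (inner ℂ (multiplier P c S x) y : ℂ) = inner ℂ x (multiplier P c S y) := by
  rw [multiplier_apply, multiplier_apply, sum_inner, inner_sum]
  refine Finset.sum_congr rfl fun i _ => ?_
  rw [inner_smul_left, inner_smul_right, Complex.conj_ofReal, hP.symm]

theorem multiplier_multiplier (c d : ι → ℝ) (S : Finset ι) (x : H) :
    multiplier P c S (multiplier P d S x) = multiplier P (fun i => c i * d i) S x := by
  classical
  rw [multiplier_apply c, multiplier_apply fun i => c i * d i]
  refine Finset.sum_congr rfl fun i hi => ?_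
  rw [hP.proj_multiplier, if_pos hi, smul_smul, Complex.ofReal_mul]

theorem multiplier_one_multiplier (c : ι → ℝ) (S : Finset ι) (x : H) :
    multiplier P 1 S (multiplier P c S x) = multiplier P c S x := by
  rw [hP.multiplier_multiplier]; simp

theorem multiplier_multiplier_one (c : ι → ℝ) (S : Finset ι) (x : H) :
    multiplier P c S (multiplier P 1 S x) = multiplier P c S x := by
  rw [hP.multiplier_multiplier]; simp

theorem norm_multiplier_sq (c : ι → ℝ) (S : Finset ι) (x : H) :
    ‖multiplier P c S x‖ ^ 2 = ∑ i ∈ S, c i ^ 2 * ‖P i x‖ ^ 2 := by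
  have h : (inner ℂ (multiplier P c S x) (multiplier P c S x) : ℂ)
      = ((∑ i ∈ S, c i ^ 2 * ‖P i x‖ ^ 2 : ℝ) : ℂ) := by
    rw [hP.inner_multiplier_left, hP.multiplier_multiplier, multiplier_apply, inner_sum]
    push_cast
    refine Finset.sum_congr rfl fun i _ => ?_
    rw [inner_smul_right, ← hP.idem i x, ← hP.symm, hP.idem, inner_self_eq_norm_sq_to_K]
    simp [sq]
  rw [inner_self_eq_norm_sq_to_K, ← RCLike.ofReal_pow] at h
  exact Complex.ofReal_injective h

theorem tendsto_multiplier_one (x : H) :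
    Tendsto (fun S => multiplier P 1 S x) atTop (𝓝 x) := by
  have := hP.hasSum x
  simpa [HasSum, multiplier_apply] using this

theorem norm_multiplier_one_le (S : Finset ι) (x : H) : ‖multiplier P 1 S x‖ ≤ ‖x‖ := by
  have h : ‖multiplier P 1 S x‖ ^ 2 ≤ ‖x‖ * ‖multiplier P 1 S x‖ := by
    have h1 : (inner ℂ (multiplier P 1 S x) (multiplier P 1 S x) : ℂ)
        = inner ℂ x (multiplier P 1 S x) := by
      rw [hP.inner_multiplier_left, hP.multiplier_one_multiplier]
    have h2 := norm_inner_le_norm (𝕜 := ℂ) x (multiplier P 1 S x)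
    rwa [← h1, inner_self_eq_norm_sq_to_K, norm_pow, RCLike.norm_ofReal, abs_norm] at h2
  rcases (norm_nonneg (multiplier P 1 S x)).eq_or_lt with h0 | h0
  · rw [← h0]; exact norm_nonneg x
  · rw [sq] at h; exact le_of_mul_le_mul_right h h0

theorem proj_of_hasSum {c : ι → ℝ} {x y : H} (h : HasSum (fun i => (c i : ℂ) • P i x) y) (i : ι) :
    P i y = (c i : ℂ) • P i x := by
  classical
  refine (h.mapL (P i)).unique ?_
  convert! hasSum_ite_eq i ((c i : ℂ) • P i x) using 2 with j
  rw [map_smul]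
  split_ifs with hj
  · rw [hj, hP.idem]
  · rw [hP.ortho i j (Ne.symm hj), smul_zero]

theorem multiplier_of_hasSum {c : ι → ℝ} {x y : H} (h : HasSum (fun i => (c i : ℂ) • P i x) y)
    (d : ι → ℝ) (S : Finset ι) :
    multiplier P d S y = multiplier P (fun i => d i * c i) S x := by
  simp only [multiplier_apply]
  refine Finset.sum_congr rfl fun i _ => ?_
  rw [hP.proj_of_hasSum h, smul_smul, Complex.ofReal_mul]

theorem norm_multiplier_le_of_hasSum {c : ι → ℝ} {x y : H}
    (h : HasSum (fun i => (c i : ℂ) • P i x) y) (S : Finset ι) : ‖multiplier P c S x‖ ≤ ‖y‖ := by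
  have := hP.norm_multiplier_one_le S y
  rw [hP.multiplier_of_hasSum h] at this
  simpa using this

/-- Truncated vectors have finite expansions, hence lie in the domain of every power of `L` and are
admissible test functions for the weak equation. -/
theorem hasSum_multiplier_one (c : ι → ℝ) (S : Finset ι) (x : H) :
    HasSum (fun i => (c i : ℂ) • P i (multiplier P 1 S x)) (multiplier P c S x) := by
  classical
  have h : ∀ i, (c i : ℂ) • P i (multiplier P 1 S x) = if i ∈ S then (c i : ℂ) • P i x else 0 := by
    intro i
    rw [hP.proj_multiplier]
    split_ifs <;> simp
  have h' : multiplier P c S x = ∑ i ∈ S, if i ∈ S then (c i : ℂ) • P i x else 0 := by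
    rw [multiplier_apply]
    exact Finset.sum_congr rfl fun i hi => (if_pos hi).symm
  rw [funext h, h']
  exact hasSum_sum_of_ne_finset_zero fun i hi => if_neg hi

/-- Poincaré inequality. -/
theorem norm_le_of_hasSum {c : ι → ℝ} {k : ℝ} (hk : 0 < k) (hc : ∀ i, P i ≠ 0 → k ≤ c i) {x y : H}
    (h : HasSum (fun i => (c i : ℂ) • P i x) y) : ‖x‖ ≤ k⁻¹ * ‖y‖ := by
  refine le_of_tendsto (hP.tendsto_multiplier_one x).norm (Eventually.of_forall fun S => ?_)
  rw [le_inv_mul_iff₀ hk]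
  refine le_trans ?_ (hP.norm_multiplier_le_of_hasSum h S)
  refine le_of_sq_le_sq ?_ (norm_nonneg _)
  rw [mul_pow, hP.norm_multiplier_sq, hP.norm_multiplier_sq, Finset.mul_sum]
  refine Finset.sum_le_sum fun i _ => ?_
  by_cases hi : P i = 0
  · simp [hi]
  · have := hc i hi
    simp only [Pi.one_apply, one_pow, one_mul]
    gcongr

end IsResolution

end Truncation

/-! ### The energy estimate for the abstract wave equation -/

section Energy

variable {H : Type*} [NormedAddCommGroup H] [InnerProductSpace ℂ H] [CompleteSpace H]
  [NormedSpace ℝ H]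

theorem Icc_mem_nhdsWithin_Ici {T t : ℝ} (ht : t ∈ Ico 0 T) : Icc 0 T ∈ 𝓝[Ici t] t :=
  mem_of_superset (Icc_mem_nhdsGE ht.2) (Icc_subset_Icc_left ht.1)

/-- A weakly differentiable function with continuous weak derivative is differentiable. -/
theorem hasDerivWithinAt_of_inner {T : ℝ} {v h : ℝ → H}
    (hh : ContinuousOn h (Icc 0 T))
    (hw : ∀ x : H, ∀ t ∈ Icc 0 T,
      HasDerivWithinAt (fun τ => (inner ℂ x (v τ) : ℂ)) (inner ℂ x (h t)) (Icc 0 T) t) :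
    ∀ t ∈ Icc 0 T, HasDerivWithinAt v (h t) (Icc 0 T) t := by
  intro t ht
  have hT : 0 ≤ T := ht.1.trans ht.2
  -- A strong primitive of `h`. Paired with any vector, `v - J` has derivative zero, so it is
  -- constant.
  let J : ℝ → H := fun t => ∫ τ in (0 : ℝ)..t, h τ
  have hJ : ∀ t ∈ Icc 0 T, HasDerivWithinAt J (h t) (Icc 0 T) t := by
    intro t ht
    have : Fact (t ∈ Icc (0 : ℝ) T) := ⟨ht⟩
    refine intervalIntegral.integral_hasDerivWithinAt_right ?_ ?_ (hh t ht)
    · exact ContinuousOn.intervalIntegrable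
        (by rw [uIcc_of_le ht.1]; exact hh.mono (Icc_subset_Icc_right ht.2))
    · exact hh.stronglyMeasurableAtFilter_nhdsWithin measurableSet_Icc t
  have hconst : ∀ t ∈ Icc 0 T, v t - J t = v 0 := by
    intro t ht
    refine ext_inner_left ℂ fun x => ?_
    have hd : ∀ r ∈ Icc 0 T,
        HasDerivWithinAt (fun τ => (inner ℂ x (v τ - J τ) : ℂ)) 0 (Icc 0 T) r := by
      intro r hr
      have h1 := (hw x r hr).sub ((hasDerivWithinAt_const r (Icc 0 T) x).inner ℂ (hJ r hr))
      simp only [inner_sub_right]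
      convert! h1 using 1
      simp
    have := constant_of_has_deriv_right_zero (fun r hr => (hd r hr).continuousWithinAt)
      (fun r hr => (hd r (Ico_subset_Icc_self hr)).mono_of_mem_nhdsWithin
        (Icc_mem_nhdsWithin_Ici hr)) t ht
    simpa [J, inner_sub_right] using this
  refine ((hJ t ht).const_add (v 0)).congr_of_mem (fun r hr => ?_) ht
  rw [← hconst r hr]; abel

/-- The energy identity, in the form of an inequality for the derivative of the energy. -/
theorem exists_hasDerivWithinAt_energy {T : ℝ} {w v g : ℝ → H} {D A : H →L[ℂ] H}
    (hDs : ∀ x y, (inner ℂ (D x) y : ℂ) = inner ℂ x (D y))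
    (hAs : ∀ x y, (inner ℂ (A x) y : ℂ) = inner ℂ x (A y))
    (hDD : ∀ x, D (D x) = D x) (hAD : ∀ x, A (D x) = A x) (hDn : ∀ x, ‖D x‖ ≤ ‖x‖)
    (hw : ∀ t ∈ Icc 0 T, HasDerivWithinAt w (v t) (Icc 0 T) t)
    (hg : ContinuousOn g (Icc 0 T))
    (heq : ∀ x, ∀ t ∈ Icc 0 T, HasDerivWithinAt (fun τ => (inner ℂ (D x) (v τ) : ℂ))
      (inner ℂ (D x) (g t) - inner ℂ (A x) (A (w t))) (Icc 0 T) t) {t : ℝ} (ht : t ∈ Icc 0 T) :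
    ∃ e ≤ 2 * ‖w t‖ * ‖v t‖ + 2 * ‖v t‖ * ‖g t‖,
      HasDerivWithinAt (fun τ => ‖w τ‖ ^ 2 + (‖D (v τ)‖ ^ 2 + ‖A (w τ)‖ ^ 2)) e (Icc 0 T) t := by
  have hwc : ContinuousOn w (Icc 0 T) := fun t ht => (hw t ht).continuousWithinAt
  -- After truncation `A` is bounded, so the right-hand side is a continuous function with values in
  -- `H` and the weak equation becomes a strong one.
  have hDv : HasDerivWithinAt (fun τ => D (v τ)) (D (g t) - A (A (w t))) (Icc 0 T) t := by
    refine hasDerivWithinAt_of_inner (v := fun τ => D (v τ))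
      (h := fun t => D (g t) - A (A (w t)))
      ((D.continuous.comp_continuousOn hg).sub
        ((A.continuous.comp A.continuous).comp_continuousOn hwc)) (fun x r hr => ?_) t ht
    simpa only [hDs, hAs, inner_sub_right] using heq x r hr
  have hAw : HasDerivWithinAt (fun τ => A (w τ)) (A (v t)) (Icc 0 T) t :=
    ((A.restrictScalars ℝ).hasFDerivAt.comp_hasDerivWithinAt t (hw t ht) :)
  have hsq : ∀ {f : ℝ → H} {f' : H}, HasDerivWithinAt f f' (Icc 0 T) t →
      HasDerivWithinAt (fun τ => ‖f τ‖ ^ 2) (2 * (inner ℂ (f t) f' : ℂ).re) (Icc 0 T) t := by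
    intro f f' hf
    have h1 := hf.inner ℂ hf
    have h2 := (Complex.reCLM.hasFDerivAt.comp_hasDerivWithinAt t h1 :)
    convert! h2 using 1
    · ext τ
      simp only [Function.comp, Complex.reCLM_apply]
      exact (inner_self_eq_norm_sq (𝕜 := ℂ) (f τ)).symm
    · rw [Complex.reCLM_apply, Complex.add_re, ← inner_conj_symm f' (f t), Complex.conj_re]
      ring
  refine ⟨_, ?_, (hsq (hw t ht)).add ((hsq hDv).add (hsq hAw))⟩
  -- The terms with `A` cancel, by symmetry of `A` and `A D = A`; only the pairing with `g`
  -- survives.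
  have e1 : (inner ℂ (D (v t)) (D (g t) - A (A (w t))) : ℂ).re
        + (inner ℂ (A (w t)) (A (v t)) : ℂ).re
      = (inner ℂ (D (v t)) (g t) : ℂ).re := by
    rw [inner_sub_right, ← hDs, hDD, ← hAs, hAD, Complex.sub_re,
      ← inner_conj_symm (A (w t)) (A (v t)), Complex.conj_re]
    ring
  have e2 : (inner ℂ (D (v t)) (g t) : ℂ).re ≤ ‖v t‖ * ‖g t‖ :=
    (Complex.re_le_norm _).trans ((norm_inner_le_norm _ _).trans (by gcongr; exact hDn _))
  have e3 : (inner ℂ (w t) (v t) : ℂ).re ≤ ‖w t‖ * ‖v t‖ :=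
    (Complex.re_le_norm _).trans (norm_inner_le_norm _ _)
  linarith

/-- The energy estimate for an abstract damped wave equation. -/
theorem energy_estimate {ι : Type*} {P : ι → H →L[ℂ] H} (hP : IsResolution P) (c : ι → ℝ)
    {T K δ α : ℝ} {w v g : ℝ → H}
    (hw : ∀ t ∈ Icc 0 T, HasDerivWithinAt w (v t) (Icc 0 T) t)
    (hv : ContinuousOn v (Icc 0 T)) (hg : ContinuousOn g (Icc 0 T))
    (heq : ∀ S : Finset ι, ∀ x, ∀ t ∈ Icc 0 T,
      HasDerivWithinAt (fun τ => (inner ℂ (multiplier P 1 S x) (v τ) : ℂ))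
        (inner ℂ (multiplier P 1 S x) (g t)
          - inner ℂ (multiplier P c S x) (multiplier P c S (w t))) (Icc 0 T) t)
    (hgb : ∀ t ∈ Icc 0 T, ‖g t‖ ≤ δ + K * (‖w t‖ + ‖v t‖))
    (h0 : ∀ S, ‖multiplier P c S (w 0)‖ ≤ α) {t : ℝ} (ht : t ∈ Icc 0 T) :
    ‖w t‖ ^ 2 + ‖v t‖ ^ 2 ≤ 2 * Real.exp (2 * (2 + 4 * K ^ 2) * T) *
      (‖w 0‖ ^ 2 + ‖v 0‖ ^ 2 + α ^ 2 + 2 * δ ^ 2 * T) := by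
  have hT : 0 ≤ T := ht.1.trans ht.2
  have hwc : ContinuousOn w (Icc 0 T) := fun t ht => (hw t ht).continuousWithinAt
  -- By Young's inequality and `‖g‖² ≤ 2 δ² + 4 K² Y`, the derivative of the energy is at most `2 δ²
  -- + B Y`, with `Y` as below.
  set B : ℝ := 2 + 4 * K ^ 2 with hB
  have hBpos : 0 < B := by positivity
  let k : ℝ := 2 * B
  let Y : ℝ → ℝ := fun t => ‖w t‖ ^ 2 + ‖v t‖ ^ 2
  have hYc : ContinuousOn (fun t => Real.exp (-k * t) * Y t) (Icc 0 T) := by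
    refine ContinuousOn.mul (by fun_prop) ((hwc.norm.pow 2).add (hv.norm.pow 2))
  -- The truncated energy does not control `Y`, so Gronwall cannot be applied for fixed `S`. Instead
  -- `Y` is bounded by `N exp (k r)`. The rate `k = 2 B` makes `B N exp (k r)` the derivative of `N
  -- / 2 * exp (k r)`, leaving a factor `1/2` to absorb.
  obtain ⟨t₀, ht₀, hmax⟩ := isCompact_Icc.exists_isMaxOn ⟨t, ht⟩ hYc
  set N : ℝ := Real.exp (-k * t₀) * Y t₀ with hN
  have hYN : ∀ r ∈ Icc 0 T, Y r ≤ N * Real.exp (k * r) := by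
    intro r hr
    have h1 : Real.exp (-k * r) * Y r ≤ N := hmax hr
    rw [neg_mul, Real.exp_neg] at h1
    rwa [inv_mul_le_iff₀ (Real.exp_pos _), mul_comm] at h1
  have hNnn : 0 ≤ N := by positivity
  set η : ℝ := ‖w 0‖ ^ 2 + ‖v 0‖ ^ 2 + α ^ 2 with hη
  have hkey : ∀ S : Finset ι, ∀ r ∈ Icc 0 T,
      ‖w r‖ ^ 2 + (‖multiplier P 1 S (v r)‖ ^ 2 + ‖multiplier P c S (w r)‖ ^ 2)
        ≤ η + 2 * δ ^ 2 * r + N / 2 * Real.exp (k * r) := by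
    intro S
    have hE : ∀ r ∈ Icc 0 T, _ := fun r (hr : r ∈ Icc 0 T) =>
      exists_hasDerivWithinAt_energy (D := multiplier P 1 S) (A := multiplier P c S)
      (hP.inner_multiplier_left 1 S) (hP.inner_multiplier_left c S)
      (hP.multiplier_one_multiplier 1 S) (hP.multiplier_multiplier_one c S)
      (hP.norm_multiplier_one_le S) hw hg (heq S) hr
    choose! e he hd using hE
    refine image_le_of_deriv_right_le_deriv_boundary
      (f' := e) (B' := fun r => 2 * δ ^ 2 + B * N * Real.exp (k * r))
      (fun r hr => (hd r hr).continuousWithinAt)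
      (fun r hr => (hd r (Ico_subset_Icc_self hr)).mono_of_mem_nhdsWithin
        (Icc_mem_nhdsWithin_Ici hr)) ?_ (by fun_prop) (fun r _ => ?_) (fun r hr => ?_)
    · have h1 := hP.norm_multiplier_one_le S (v 0)
      have h2 := h0 S
      have h3 : ‖multiplier P 1 S (v 0)‖ ^ 2 ≤ ‖v 0‖ ^ 2 := by gcongr
      have h4 : ‖multiplier P c S (w 0)‖ ^ 2 ≤ α ^ 2 := by gcongr
      simp only [mul_zero, Real.exp_zero]
      linarith
    · have h1 : HasDerivAt (fun r : ℝ => η + 2 * δ ^ 2 * r + N / 2 * Real.exp (k * r))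
          (2 * δ ^ 2 * 1 + N / 2 * (Real.exp (k * r) * (k * 1))) r :=
        (((hasDerivAt_id r).const_mul (2 * δ ^ 2)).const_add η).add
          ((((hasDerivAt_id r).const_mul k).exp).const_mul (N / 2))
      convert! h1.hasDerivWithinAt using 1
      simp only [k]; ring
    · have hr' := Ico_subset_Icc_self hr
      refine (he r hr').trans ?_
      have h1 := hgb r hr'
      have h2 : B * Y r ≤ B * N * Real.exp (k * r) := by
        rw [mul_assoc]; exact mul_le_mul_of_nonneg_left (hYN r hr') hBpos.le
      have h3 : ‖g r‖ ^ 2 ≤ 2 * δ ^ 2 + 4 * K ^ 2 * Y r := by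
        have h4 : ‖g r‖ ^ 2 ≤ (δ + K * (‖w r‖ + ‖v r‖)) ^ 2 := by gcongr
        simp only [Y]
        nlinarith [sq_nonneg (δ - K * (‖w r‖ + ‖v r‖)), sq_nonneg (K * (‖w r‖ - ‖v r‖))]
      simp only [hB, Y] at h2 h3 ⊢
      nlinarith [sq_nonneg (‖w r‖ - ‖v r‖), sq_nonneg (‖v r‖ - ‖g r‖), sq_nonneg (‖w r‖)]
  -- The bound is uniform in `S`, so the truncation of `v` is removed in the limit and the
  -- nonnegative term with `c` is dropped.
  have hY : ∀ r ∈ Icc 0 T, Y r ≤ η + 2 * δ ^ 2 * r + N / 2 * Real.exp (k * r) := by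
    intro r hr
    have hlim : Tendsto (fun S => ‖w r‖ ^ 2 + ‖multiplier P 1 S (v r)‖ ^ 2) atTop (𝓝 (Y r)) :=
      tendsto_const_nhds.add ((hP.tendsto_multiplier_one (v r)).norm.pow 2)
    refine le_of_tendsto hlim (Eventually.of_forall fun S => ?_)
    have h1 := hkey S r hr
    have h2 := sq_nonneg ‖multiplier P c S (w r)‖
    linarith
  -- Evaluation at the maximum point `t₀` gives `N` on the left and `N / 2` on the right.
  have hN2 : N ≤ 2 * (η + 2 * δ ^ 2 * T) := by
    have h1 := hY t₀ ht₀
    have h2 : N ≤ Real.exp (-k * t₀) * (η + 2 * δ ^ 2 * T) + N / 2 := by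
      have e1 : Real.exp (-k * t₀) * Real.exp (k * t₀) = 1 := by
        rw [← Real.exp_add]; simp
      calc N ≤ Real.exp (-k * t₀) * (η + 2 * δ ^ 2 * T + N / 2 * Real.exp (k * t₀)) := by
            rw [hN]
            gcongr
            refine h1.trans ?_
            have := ht₀.2
            gcongr
        _ = Real.exp (-k * t₀) * (η + 2 * δ ^ 2 * T)
              + N / 2 * (Real.exp (-k * t₀) * Real.exp (k * t₀)) := by ring
        _ = _ := by rw [e1, mul_one]
    have h3 : Real.exp (-k * t₀) ≤ 1 := by
      rw [Real.exp_le_one_iff]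
      have := ht₀.1
      have : 0 ≤ k * t₀ := by positivity
      linarith
    have h4 : 0 ≤ η + 2 * δ ^ 2 * T := by positivity
    nlinarith [mul_le_mul_of_nonneg_right h3 h4]
  have h5 : Real.exp (k * t) ≤ Real.exp (k * T) := by
    have := ht.2
    gcongr
  calc Y t ≤ N * Real.exp (k * t) := hYN t ht
    _ ≤ 2 * (η + 2 * δ ^ 2 * T) * Real.exp (k * T) := by gcongr
    _ = _ := by simp only [k, hη]; ring

end Energy

/-! ### Solutions of the problem and their continuous dependence on the data -/

theorem IsSolution.hasDerivWithinAt {q : LInf} {s T : ℝ} {a b : LInf} {u₀ u₁ : L2} {u : ℝ → L2}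
    (hu : IsSolution q s T a b u₀ u₁ u) {t : ℝ} (ht : t ∈ Icc 0 T) :
    HasDerivWithinAt u (dt T u t) (Icc 0 T) t :=
  ((hu.contDiffOn.differentiableOn one_ne_zero) t ht).hasDerivWithinAt

theorem IsSolution.continuousOn_dt {q : LInf} {s T : ℝ} (hT : 0 < T) {a b : LInf} {u₀ u₁ : L2}
    {u : ℝ → L2} (hu : IsSolution q s T a b u₀ u₁ u) : ContinuousOn (dt T u) (Icc 0 T) :=
  hu.contDiffOn.continuousOn_derivWithin (uniqueDiffOn_Icc hT) le_rfl

theorem IsSolution.continuousOn {q : LInf} {s T : ℝ} {a b : LInf} {u₀ u₁ : L2}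
    {u : ℝ → L2} (hu : IsSolution q s T a b u₀ u₁ u) : ContinuousOn u (Icc 0 T) :=
  hu.contDiffOn.continuousOn

theorem ofReal_smul_L2 (r : ℝ) (f : L2) : (r : ℂ) • f = r • f := by
  rw [← smul_one_smul ℂ r f]; simp

theorem memDomPow_iff (q : LInf) (r : ℝ) (f : L2) :
    MemDomPow q r f ↔ Summable fun lam : ℝ => ((lam ^ r : ℝ) : ℂ) • spectralProj q lam f := by
  simp only [MemDomPow, ofReal_smul_L2]

theorem fracPow_eq (q : LInf) (r : ℝ) (f : L2) :
    fracPow q r f = ∑' lam : ℝ, ((lam ^ r : ℝ) : ℂ) • spectralProj q lam f := by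
  simp only [fracPow, ofReal_smul_L2]

theorem MemDomPow.hasSum {q : LInf} {r : ℝ} {f : L2} (hf : MemDomPow q r f) :
    HasSum (fun lam : ℝ => ((lam ^ r : ℝ) : ℂ) • spectralProj q lam f) (fracPow q r f) := by
  rw [fracPow_eq]
  exact ((memDomPow_iff q r f).1 hf).hasSum

theorem MemDomPow.sub {q : LInf} {r : ℝ} {f g : L2} (hf : MemDomPow q r f)
    (hg : MemDomPow q r g) : MemDomPow q r (f - g) := by
  refine (Summable.sub hf hg).congr fun lam => ?_
  rw [map_sub, smul_sub]

/-- The equation of a solution, tested with a spectrally truncated function. -/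
theorem IsSolution.equation_multiplier {q : LInf} {s T : ℝ} {a b : LInf} {u₀ u₁ : L2}
    {u : ℝ → L2} (hP : IsResolution (spectralProj q)) (hu : IsSolution q s T a b u₀ u₁ u)
    (S : Finset ℝ) (x : L2) {t : ℝ} (ht : t ∈ Icc 0 T) :
    HasDerivWithinAt (fun τ => (inner ℂ (multiplier (spectralProj q) 1 S x) (dt T u τ) : ℂ))
      (-(inner ℂ (multiplier (spectralProj q) (fun lam => lam ^ (s / 2)) S x)
          (multiplier (spectralProj q) (fun lam => lam ^ (s / 2)) S (u t))
        + inner ℂ (multiplier (spectralProj q) 1 S x) (a • u t : L2)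
        + inner ℂ (multiplier (spectralProj q) 1 S x) (b • dt T u t : L2))) (Icc 0 T) t := by
  have hs := hP.hasSum_multiplier_one (fun lam => lam ^ (s / 2)) S x
  have h := hu.equation _ ((memDomPow_iff q (s / 2) _).2 hs.summable) t ht
  rw [fracPow_eq, hs.tsum_eq] at h
  -- The truncation sits in the test function. By symmetry it passes to `fracPow q (s / 2) (u t)`,
  -- where it is the bounded multiplier applied to `u t`.
  have e : (inner ℂ (multiplier (spectralProj q) (fun lam => lam ^ (s / 2)) S x)
        (fracPow q (s / 2) (u t)) : ℂ)
      = inner ℂ (multiplier (spectralProj q) (fun lam => lam ^ (s / 2)) S x)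
          (multiplier (spectralProj q) (fun lam => lam ^ (s / 2)) S (u t)) := by
    rw [hP.inner_multiplier_left, hP.inner_multiplier_left, hP.multiplier_multiplier,
      hP.multiplier_of_hasSum (hu.memW t ht).hasSum]
  rwa [e] at h

/-- The splitting puts the perturbed coefficient on the difference and the coefficient error on the
unperturbed `f`, so no bound on the perturbed solution enters. -/
theorem norm_smul_sub_smul_le (a a' : LInf) (f f' : L2) :
    ‖(a' • f' - a • f : L2)‖ ≤ ‖a'‖ * ‖f' - f‖ + ‖a' - a‖ * ‖f‖ := by
  have e : (a' • f' - a • f : L2) = (a' • (f' - f) : L2) + ((a' - a) • f : L2) := by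
    rw [sub_eq_add_neg f' f, Lp.add_smul, Lp.smul_neg, sub_eq_add_neg a' a, Lp.smul_add,
      Lp.neg_smul]
    abel
  rw [e]
  exact (norm_add_le _ _).trans (add_le_add (Lp.norm_smul_le _ _) (Lp.norm_smul_le _ _))

theorem continuousOn_smul_L2 (a : LInf) {f : ℝ → L2} {I : Set ℝ} (hf : ContinuousOn f I) :
    ContinuousOn (fun t => (a • f t : L2)) I :=
  (mulOp a).continuous.comp_continuousOn hf

/-- Continuous dependence of solutions on the coefficients and the initial data. -/
theorem IsSolution.norm_sub_sq_le {q : LInf} {s T : ℝ} (hT : 0 < T)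
    (hP : IsResolution (spectralProj q)) {a b a' b' : LInf} {u₀ u₁ u₀' u₁' : L2} {u u' : ℝ → L2}
    (hu : IsSolution q s T a b u₀ u₁ u) (hu' : IsSolution q s T a' b' u₀' u₁' u') {M K : ℝ}
    (hM : ∀ t ∈ Icc 0 T, ‖u t‖ ≤ M ∧ ‖dt T u t‖ ≤ M) (ha : ‖a'‖ ≤ K) (hb : ‖b'‖ ≤ K)
    {t : ℝ} (ht : t ∈ Icc 0 T) :
    ‖u' t - u t‖ ^ 2 ≤ 2 * Real.exp (2 * (2 + 4 * K ^ 2) * T) *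
      (‖u₀' - u₀‖ ^ 2 + ‖u₁' - u₁‖ ^ 2 + normW q s (u₀' - u₀) ^ 2
        + 2 * ((‖a' - a‖ + ‖b' - b‖) * M) ^ 2 * T) := by
  have h0 : (0 : ℝ) ∈ Icc 0 T := ⟨le_rfl, hT.le⟩
  have hW : MemDomPow q (s / 2) (u' 0 - u 0) := (hu'.memW 0 h0).sub (hu.memW 0 h0)
  have key := energy_estimate hP (fun lam => lam ^ (s / 2)) (T := T) (K := K)
    (δ := (‖a' - a‖ + ‖b' - b‖) * M) (α := normW q s (u₀' - u₀))
    (w := fun t => u' t - u t) (v := fun t => dt T u' t - dt T u t)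
    (g := fun t => -((a' • u' t - a • u t : L2) + (b' • dt T u' t - b • dt T u t : L2)))
    (fun t ht => (hu'.hasDerivWithinAt ht).sub (hu.hasDerivWithinAt ht))
    ((hu'.continuousOn_dt hT).sub (hu.continuousOn_dt hT))
    (((continuousOn_smul_L2 a' hu'.continuousOn).sub (continuousOn_smul_L2 a hu.continuousOn)).add
      ((continuousOn_smul_L2 b' (hu'.continuousOn_dt hT)).sub
        (continuousOn_smul_L2 b (hu.continuousOn_dt hT)))).neg
    (fun S x t ht => ?_) (fun t ht => ?_) (fun S => ?_) ht
  · simp only [hu.initial, hu'.initial, hu.initial_dt, hu'.initial_dt] at key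
    exact (le_add_of_nonneg_right (sq_nonneg _)).trans key
  · have h1 := (hu'.equation_multiplier hP S x ht).sub (hu.equation_multiplier hP S x ht)
    convert! h1 using 1
    · ext τ
      simp
    · simp only [inner_neg_right, inner_add_right, inner_sub_right, map_sub]
      ring
  · rw [norm_neg]
    obtain ⟨hm1, hm2⟩ := hM t ht
    calc _ ≤ ‖a'‖ * ‖u' t - u t‖ + ‖a' - a‖ * ‖u t‖
          + (‖b'‖ * ‖dt T u' t - dt T u t‖ + ‖b' - b‖ * ‖dt T u t‖) :=
          (norm_add_le _ _).trans
            (add_le_add (norm_smul_sub_smul_le _ _ _ _) (norm_smul_sub_smul_le _ _ _ _))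
      _ ≤ K * ‖u' t - u t‖ + ‖a' - a‖ * M + (K * ‖dt T u' t - dt T u t‖ + ‖b' - b‖ * M) := by
          gcongr
      _ = _ := by ring
  · have h2 := hP.norm_multiplier_le_of_hasSum hW.hasSum S
    simpa only [hu.initial, hu'.initial, normW] using h2

/-- The norm of `W^s_L` dominates that of `L²`. -/
theorem exists_norm_le_normW {q : LInf} (hq : ∀ lam : ℝ, IsEigenvalue q lam → 0 < lam) {s : ℝ}
    (hs : 0 ≤ s) : ∃ C : ℝ, ∀ f : L2, MemW q s f → ‖f‖ ≤ C * normW q s f := by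
  obtain ⟨hP, m, hm, hm0⟩ := resolution_spectralProj q hq
  refine ⟨(m ^ (s / 2))⁻¹, fun f hf =>
    hP.norm_le_of_hasSum (Real.rpow_pos_of_pos hm _) (fun lam hlam => ?_) hf.hasSum⟩
  have : m ≤ lam := le_of_not_gt fun h => hlam (hm0 lam h)
  exact Real.rpow_le_rpow hm.le this (by positivity)

end SturmLiouville

end

theorem mainTheorem9 (T s : ℝ) (hT : 0 < T) (hs : 0 ≤ s)
    (q : SturmLiouville.LInf)
    (hq : ∀ lam : ℝ, SturmLiouville.IsEigenvalue q lam → 0 < lam)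
    (a b : SturmLiouville.LInf) (ha : 0 ≤ a) (hb : 0 ≤ b)
    (u₀ u₁ : SturmLiouville.L2) (hu₀ : SturmLiouville.MemW q s u₀)
    (u : ℝ → SturmLiouville.L2) (hu : SturmLiouville.IsSolution q s T a b u₀ u₁ u)
    (aε bε : ℝ → SturmLiouville.LInf) (u₀ε u₁ε : ℝ → SturmLiouville.L2)
    (ha_lim : Tendsto (fun ε => ‖aε ε - a‖) (𝓝[>] 0) (𝓝 0))
    (hb_lim : Tendsto (fun ε => ‖bε ε - b‖) (𝓝[>] 0) (𝓝 0))
    (hu₀_lim : Tendsto (fun ε => SturmLiouville.normW q s (u₀ε ε - u₀)) (𝓝[>] 0) (𝓝 0))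
    (hu₁_lim : Tendsto (fun ε => ‖u₁ε ε - u₁‖) (𝓝[>] 0) (𝓝 0))
    (uε : ℝ → ℝ → SturmLiouville.L2)
    (huε : SturmLiouville.IsVeryWeakSolution q s T aε bε u₀ε u₁ε uε) :
    TendstoUniformlyOn uε u (𝓝[>] 0) (Icc 0 T) := by
  open SturmLiouville in
  have hP := (resolution_spectralProj q hq).1
  obtain ⟨C, hC⟩ := exists_norm_le_normW hq hs
  obtain ⟨M₁, hM₁⟩ := isCompact_Icc.exists_bound_of_continuousOn hu.continuousOn
  obtain ⟨M₂, hM₂⟩ := isCompact_Icc.exists_bound_of_continuousOn (hu.continuousOn_dt hT)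
  let M := max M₁ M₂
  -- Bounds the perturbed coefficients as soon as they are within `1` of their limits.
  let K := max (‖a‖ + 1) (‖b‖ + 1)
  have hIoc : ∀ᶠ ε : ℝ in 𝓝[>] 0, ε ∈ Ioc (0 : ℝ) 1 := Ioc_mem_nhdsGT one_pos
  -- The energy estimate also contains the `L²` norm of the initial error, which the Poincaré
  -- inequality controls by the `W^s_L` norm.
  have hu₀_lim' : Tendsto (fun ε => ‖u₀ε ε - u₀‖) (𝓝[>] 0) (𝓝 0) := by
    refine squeeze_zero' (Eventually.of_forall fun _ => norm_nonneg _) ?_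
      (by simpa using hu₀_lim.const_mul C)
    filter_upwards [hIoc] with ε hε
    exact hC _ (MemDomPow.sub (huε.memW ε hε) hu₀)
  have hlim : Tendsto (fun ε => 2 * Real.exp (2 * (2 + 4 * K ^ 2) * T) *
      (‖u₀ε ε - u₀‖ ^ 2 + ‖u₁ε ε - u₁‖ ^ 2 + normW q s (u₀ε ε - u₀) ^ 2
        + 2 * ((‖aε ε - a‖ + ‖bε ε - b‖) * M) ^ 2 * T)) (𝓝[>] 0) (𝓝 0) := by
    simpa using ((((hu₀_lim'.pow 2).add (hu₁_lim.pow 2)).add (hu₀_lim.pow 2)).add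
      (((((ha_lim.add hb_lim).mul_const M).pow 2).const_mul 2).mul_const T)).const_mul
      (2 * Real.exp (2 * (2 + 4 * K ^ 2) * T))
  rw [Metric.tendstoUniformlyOn_iff]
  intro η hη
  filter_upwards [hIoc, ha_lim.eventually_le_const one_pos, hb_lim.eventually_le_const one_pos,
    hlim.eventually_lt_const (pow_pos hη 2)] with ε hε h1 h2 h3 t ht
  have hbound : ∀ {c c' : LInf}, ‖c' - c‖ ≤ 1 → ‖c'‖ ≤ ‖c‖ + 1 := fun {c c'} h =>
    (norm_le_norm_add_norm_sub' c' c).trans (by gcongr)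
  rw [dist_comm, dist_eq_norm]
  refine lt_of_pow_lt_pow_left₀ 2 hη.le (lt_of_le_of_lt ?_ h3)
  exact hu.norm_sub_sq_le hT hP (huε.isSolution ε hε)
    (fun t ht => ⟨(hM₁ t ht).trans (le_max_left _ _), (hM₂ t ht).trans (le_max_right _ _)⟩)
    ((hbound h1).trans (le_max_left _ _)) ((hbound h2).trans (le_max_right _ _)) ht
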